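/- Let $d\ge 0$, let $\|\cdot\|_c$ be any norm on $\mathbb R^d$, and let $T:\mathbb R^d\to\mathbb R^d$ satisfy $\|T(x)-T(y)\|_c\le\gamma\|x-y\|_c$ for all $x,y$, where $\gamma\in(0,1)$. Let $\theta^*$ be the (unique) fixed point of $T$, and let $\nu$ be a probability distribution on $\mathbb R^d$ with mean zero and finite second moment. For a stepsize $\alpha>0$ consider $$\theta_{t+1}^{(\alpha)}=\theta_t^{(\alpha)}+\alpha\big(T(\theta_t^{(\alpha)})-\theta_t^{(\alpha)}+w_t\big),\qquad t\ge 0,$$ where $w_0,w_1,\dots$ are i.i.d. with law $\nu$ and $\theta_0^{(\alpha)}$ is a random vector independent of $(w_t)_{t\ge0}$. Let $W_2(\mu,\mu')=\inf_\xi\big(\int\|u-v\|_c^2\,d\xi(u,v)\big)^{1/2}$, the infimum being over all couplings $\xi$ of $\mu$ and $\mu'$, and write $\mathcal L(X)$ for the law of $X$. Then there is $\bar\alpha>0$ such that for every $\alpha\in(0,\bar\alpha]$ we have $1-\alpha(1-\sqrt\gamma)\in(0,1)$, and the Markov chain $(\theta_t^{(\alpha)})_{t\ge0}$ has exactly one stationary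 probability distribution $\mathcal L(\theta^{(\alpha)})$; this distribution has finite second moment, and the following hold. 1. For every $R$ there is a constant $c$, independent of $\alpha$ and $t$, such that for every $\alpha\in(0,\bar\alpha]$ and every initial vector $\theta_0^{(\alpha)}$ with $\mathbb E\|\theta_0^{(\alpha)}\|_2^2\le R$, $$W_2^2\big(\mathcal L(\theta_t^{(\alpha)}),\mathcal L(\theta^{(\alpha)})\big)\le c\,\big(1-\alpha(1-\sqrt\gamma)\big)^t\qquad\text{for all }t\ge 0.$$ 2. There is a constant $M$, independent of $\alpha$, such that $\mathbb E\|\theta^{(\alpha)}-\theta^*\|_2^2\le M\alpha$ for every $\alpha\in(0,\bar\alpha]$. -/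

import Mathlib

open MeasureTheory ProbabilityTheory
open scoped ENNReal

namespace ContractiveSA

noncomputable section

/-- The Wasserstein distance of order two between laws on `E`, with respect to the norm `p`:
the infimum, over all couplings `ξ` of `μ` and `ν`, of `(∫ p (u - v) ^ 2 dξ(u, v)) ^ (1 / 2)`.
It takes values in `[0, ∞]`, and is finite for laws with finite second moments. -/
def W2 {E : Type*} [AddCommGroup E] [Module ℝ E] [MeasurableSpace E]
    (p : Seminorm ℝ E) (μ ν : Measure E) : ℝ≥0∞ :=
  ⨅ (ξ : Measure (E × E)) (_ : ξ.fst = μ ∧ ξ.snd = ν),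
    (∫⁻ z, ENNReal.ofReal (p (z.1 - z.2)) ^ 2 ∂ξ) ^ (1 / 2 : ℝ)

/-- `T` is `γ`-contractive with respect to the norm `p`, for a factor `γ ∈ (0, 1)`. -/
def IsContractive {E : Type*} [AddCommGroup E] [Module ℝ E]
    (p : Seminorm ℝ E) (γ : ℝ) (T : E → E) : Prop :=
  0 < γ ∧ γ < 1 ∧ ∀ x y, p (T x - T y) ≤ γ * p (x - y)

/-- One step of stochastic approximation with additive noise: from the iterate `x`, with noise
value `v` and stepsize `α`. -/
def saStep {E : Type*} [AddCommGroup E] [Module ℝ E]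
    (T : E → E) (α : ℝ) (x v : E) : E :=
  x + α • (T x - x + v)

/-- The sequence `θ` of random vectors on `(Ω, P)` is generated by stochastic approximation with
stepsize `α`, driven by the i.i.d. noise `w` of law `ν`, from a random initial vector `θ 0` that
is independent of the noise sequence. -/
structure IsSAProcess {E Ω : Type*} [AddCommGroup E] [Module ℝ E] [MeasurableSpace E]
    [MeasurableSpace Ω] (P : Measure Ω) (T : E → E) (ν : Measure E) (α : ℝ)
    (w θ : ℕ → Ω → E) : Prop where
  measurable_noise : ∀ t, Measurable (w t)
  law_noise : ∀ t, P.map (w t) = ν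
  indep_noise : iIndepFun w P
  measurable_init : Measurable (θ 0)
  indep_init : IndepFun (θ 0) (fun ω t => w t ω) P
  step : ∀ t ω, θ (t + 1) ω = saStep T α (θ t ω) (w t ω)

/-- The transition kernel of the Markov chain of iterates: `x` is sent to the law of
`saStep T α x v` where `v` has law `ν`. -/
def saKernel {E : Type*} [AddCommGroup E] [Module ℝ E] [MeasurableSpace E]
    (T : E → E) (ν : Measure E) [SFinite ν] (α : ℝ) : Kernel E E :=
  (Kernel.id ×ₖ Kernel.const E ν).map (fun z => saStep T α z.1 z.2)

end

end ContractiveSA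

/-!
The noise is additive, so two chains driven by the same noise get closer at every step and on every
path: their distance in the norm `p` is multiplied by at most `1 - α (1 - γ)`
(`IsContractive.saStep_sub_le`), for every stepsize `α ≤ 1`. Running an arbitrary coupling of two
initial laws in this synchronous way (`syncStep`) therefore gives both the geometric bound in
Wasserstein distance (`W2_sq_map_le`) and, with a bounded cost in place of the quadratic one, the
uniqueness of the stationary law (`invariant_unique`).

A stationary law is the law of a stationary solution `X = saStep T α (X ∘ S) W`, where `S` is the
shift on the space of noise sequences and `W` is the present noise value. Such an `X` is the fixed
point of a map of `L²` with a contracting iterate (`exists_stationary_solution`).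

For the mean square error no smoothing of the norm `p` is needed. Let `Z` be the stationary
solution of the linear recursion `Z = (1 - α) Z ∘ S + α W`. As `W` is centred and independent of
`Z ∘ S`, the second moment of `Z` is at most `α` times that of the noise
(`integral_norm_sq_linear_le`). The remainder `U = X - θ⋆ - Z` satisfies
`U = (1 - α) U ∘ S + α (T (X ∘ S) - T θ⋆)`, hence
`p U ≤ (1 - α (1 - γ)) p (U ∘ S) + α γ p (Z ∘ S)` pathwise. By stationarity the second moment of
`p U` is at most `(γ / (1 - γ))²` times that of `p Z` (`integral_norm_sub_sq_le`), which is of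
order `α` as well.
-/

namespace ContractiveSA

/-! ### Comparison of the two norms -/

/-- The seminorm `p` is equivalent to the norm of `E`, with the constant `C` on both sides. -/
structure IsEquivNorm {E : Type*} [NormedAddCommGroup E] [Module ℝ E]
    (p : Seminorm ℝ E) (C : ℝ) : Prop where
  pos : 0 < C
  le_norm : ∀ x, p x ≤ C * ‖x‖
  norm_le : ∀ x, ‖x‖ ≤ C * p x

theorem exists_isEquivNorm {E : Type*} [NormedAddCommGroup E] [NormedSpace ℝ E]
    [FiniteDimensional ℝ E] (p : Seminorm ℝ E) (hp : ∀ x, p x = 0 → x = 0) :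
    ∃ C, IsEquivNorm p C := by
  have hcont : Continuous p := by
    rw [← continuousOn_univ]
    simpa using! p.convexOn.continuousOn_interior
  obtain ⟨C₁, hC₁, h₁⟩ := p.bound_of_continuous_normedSpace hcont
  -- On the compact unit sphere `p` is bounded below by a positive constant.
  obtain ⟨C₂, h₂⟩ : ∃ C, ∀ x, ‖x‖ ≤ C * p x := by
    have := FiniteDimensional.proper ℝ E
    rcases (Metric.sphere (0 : E) 1).eq_empty_or_nonempty with he | hne
    · refine ⟨0, fun x => ?_⟩
      by_contra! hx
      have hx' : ‖x‖ ≠ 0 := by intro h; simp [h] at hx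
      have : ‖x‖⁻¹ • x ∈ Metric.sphere (0 : E) 1 := by
        simp [norm_smul, hx']
      simp [he] at this
    · obtain ⟨u, hu, hmin⟩ := (isCompact_sphere (0 : E) 1).exists_isMinOn hne hcont.continuousOn
      have hpu : 0 < p u := by
        refine (apply_nonneg p u).lt_of_ne fun h => ?_
        have h0 := hp u h.symm
        simp [h0] at hu
      refine ⟨(p u)⁻¹, fun x => ?_⟩
      rcases eq_or_ne x 0 with rfl | hx
      · simp
      have hx' : 0 < ‖x‖ := norm_pos_iff.2 hx
      have hmem : ‖x‖⁻¹ • x ∈ Metric.sphere (0 : E) 1 := by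
        simp [norm_smul, hx'.ne']
      have := hmin hmem
      simp only [Set.mem_ofPred_eq, map_smul_eq_mul, norm_inv, norm_norm] at this
      rw [inv_mul_eq_div, le_div_iff₀ hpu]
      rw [inv_mul_eq_div, le_div_iff₀ hx'] at this
      linarith
  refine ⟨max C₁ C₂, lt_max_of_lt_left hC₁, fun x => (h₁ x).trans ?_, fun x => (h₂ x).trans ?_⟩
  · gcongr; exact le_max_left ..
  · gcongr; exact le_max_right ..

section NormedSpace

variable {E : Type*} [NormedAddCommGroup E] [NormedSpace ℝ E] {p : Seminorm ℝ E} {C γ α : ℝ}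
  {T : E → E}

theorem IsEquivNorm.continuous (hp : IsEquivNorm p C) : Continuous p :=
  Seminorm.continuous_of_le (q := C.toNNReal • normSeminorm ℝ E)
    (by simpa using! continuous_norm.const_smul C.toNNReal)
    fun x => by simpa [NNReal.smul_def, hp.pos.le] using hp.le_norm x

theorem IsContractive.continuous (hp : IsEquivNorm p C) (hT : IsContractive p γ T) :
    Continuous T := by
  refine (LipschitzWith.of_dist_le_mul (K := (C * (γ * C)).toNNReal) fun x y => ?_).continuous
  have hC := hp.pos
  have hγ := hT.1
  rw [Real.coe_toNNReal _ (by positivity), dist_eq_norm, dist_eq_norm]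
  calc ‖T x - T y‖ ≤ C * p (T x - T y) := hp.norm_le _
    _ ≤ C * (γ * (C * ‖x - y‖)) := by
      gcongr
      exact (hT.2.2 x y).trans (by gcongr; exact hp.le_norm _)
    _ = _ := by ring

theorem isContractive_const (hγ : 0 < γ) (hγ' : γ < 1) (x : E) :
    IsContractive p γ (fun _ => x) :=
  ⟨hγ, hγ', fun _ _ => by simp only [sub_self, map_zero]; positivity⟩

/-- The noise is additive, hence it cancels when two iterates driven by the same noise are
compared: the step contracts their distance pathwise. -/
theorem IsContractive.saStep_sub_le (hT : IsContractive p γ T) (hα : 0 < α) (hα' : α ≤ 1)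
    (x y v : E) :
    p (saStep T α x v - saStep T α y v) ≤ (1 - α * (1 - γ)) * p (x - y) := by
  have h : saStep T α x v - saStep T α y v = (1 - α) • (x - y) + α • (T x - T y) := by
    unfold saStep; module
  rw [h]
  refine (map_add_le_add p _ _).trans ?_
  rw [map_smul_eq_mul, map_smul_eq_mul, Real.norm_of_nonneg (by linarith),
    Real.norm_of_nonneg hα.le]
  nlinarith [mul_le_mul_of_nonneg_left (hT.2.2 x y) hα.le]

theorem IsContractive.rate_mem (hT : IsContractive p γ T) (hα : 0 < α) (hα' : α ≤ 1) :
    1 - α * (1 - γ) ∈ Set.Ioo (0 : ℝ) 1 := by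
  obtain ⟨h0, h1, -⟩ := hT
  constructor <;> nlinarith

theorem continuous_saStep (hT : Continuous T) (α : ℝ) :
    Continuous (fun z : E × E => saStep T α z.1 z.2) := by
  unfold saStep; fun_prop

variable [MeasurableSpace E] {ν : Measure E}

/-! ### The synchronous coupling -/

/-- One step of the synchronous coupling: both components of a pair of law `ξ` make a step of the
chain, with the same noise value. -/
noncomputable def syncStep (T : E → E) (ν : Measure E) (α : ℝ) (ξ : Measure (E × E)) :
    Measure (E × E) :=
  (ξ.prod ν).map (fun z => (saStep T α z.1.1 z.2, saStep T α z.1.2 z.2))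

instance [IsProbabilityMeasure ν] (ξ : Measure (E × E)) [SFinite ξ] :
    SFinite (syncStep T ν α ξ) := by
  unfold syncStep; infer_instance

theorem sFinite_iterate_syncStep [IsProbabilityMeasure ν] (ξ : Measure (E × E)) [SFinite ξ]
    (n : ℕ) : SFinite ((syncStep T ν α)^[n] ξ) := by
  induction n with
  | zero => simpa
  | succ n ih => rw [Function.iterate_succ_apply']; infer_instance

variable [BorelSpace E] [SecondCountableTopology E]

theorem measurable_saStep (hT : Continuous T) (α : ℝ) :
    Measurable (fun z : E × E => saStep T α z.1 z.2) :=
  (continuous_saStep hT α).measurable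

theorem invariant_saKernel_iff [SFinite ν] (hT : Continuous T) {π : Measure E} [SFinite π] :
    Kernel.Invariant (saKernel T ν α) π ↔
      (π.prod ν).map (fun z => saStep T α z.1 z.2) = π := by
  rw [Kernel.Invariant, saKernel, ← Measure.map_comp _ _ (measurable_saStep hT α),
    ← Measure.compProd_eq_comp_prod, Measure.compProd_const]

theorem measurable_saStep_pair (hT : Continuous T) (α : ℝ) :
    Measurable (fun z : (E × E) × E => (saStep T α z.1.1 z.2, saStep T α z.1.2 z.2)) := by
  have h := measurable_saStep hT α
  exact (h.comp (by fun_prop : Measurable fun z : (E × E) × E => (z.1.1, z.2))).prodMk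
    (h.comp (by fun_prop : Measurable fun z : (E × E) × E => (z.1.2, z.2)))

theorem fst_syncStep [IsProbabilityMeasure ν] (hT : Continuous T) (ξ : Measure (E × E))
    [SFinite ξ] :
    (syncStep T ν α ξ).fst = (ξ.fst.prod ν).map (fun z => saStep T α z.1 z.2) := by
  have h : ξ.fst.prod ν = (ξ.prod ν).map (Prod.map Prod.fst id) := by
    rw [← Measure.map_prod_map _ _ measurable_fst measurable_id, Measure.map_id, Measure.fst]
  rw [h, Measure.fst, syncStep, Measure.map_map measurable_fst (measurable_saStep_pair hT α),
    Measure.map_map (measurable_saStep hT α) (by fun_prop)]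
  rfl

theorem snd_syncStep [IsProbabilityMeasure ν] (hT : Continuous T) (ξ : Measure (E × E))
    [SFinite ξ] :
    (syncStep T ν α ξ).snd = (ξ.snd.prod ν).map (fun z => saStep T α z.1 z.2) := by
  have h : ξ.snd.prod ν = (ξ.prod ν).map (Prod.map Prod.snd id) := by
    rw [← Measure.map_prod_map _ _ measurable_snd measurable_id, Measure.map_id, Measure.snd]
  rw [h, Measure.snd, syncStep, Measure.map_map measurable_snd (measurable_saStep_pair hT α),
    Measure.map_map (measurable_saStep hT α) (by fun_prop)]
  rfl

/-- If the laws `μ n` evolve along the chain, the iterated coupling has them as first marginals. -/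
theorem fst_iterate_syncStep [IsProbabilityMeasure ν] (hT : Continuous T) {ξ : Measure (E × E)}
    [SFinite ξ] {μ : ℕ → Measure E} (h0 : ξ.fst = μ 0)
    (hμ : ∀ n, ((μ n).prod ν).map (fun z => saStep T α z.1 z.2) = μ (n + 1)) (n : ℕ) :
    ((syncStep T ν α)^[n] ξ).fst = μ n := by
  induction n with
  | zero => simpa
  | succ n ih =>
    have := sFinite_iterate_syncStep (T := T) (ν := ν) (α := α) ξ n
    rw [Function.iterate_succ_apply', fst_syncStep hT, ih, hμ]

theorem snd_iterate_syncStep [IsProbabilityMeasure ν] (hT : Continuous T) {ξ : Measure (E × E)}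
    [SFinite ξ] {μ : ℕ → Measure E} (h0 : ξ.snd = μ 0)
    (hμ : ∀ n, ((μ n).prod ν).map (fun z => saStep T α z.1 z.2) = μ (n + 1)) (n : ℕ) :
    ((syncStep T ν α)^[n] ξ).snd = μ n := by
  induction n with
  | zero => simpa
  | succ n ih =>
    have := sFinite_iterate_syncStep (T := T) (ν := ν) (α := α) ξ n
    rw [Function.iterate_succ_apply', snd_syncStep hT, ih, hμ]

/-- The distance of the two components contracts by the factor `1 - α (1 - γ)` at each step of the
coupling. The cost `g` is arbitrary: a quadratic cost gives the Wasserstein bound, a bounded one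
gives uniqueness among stationary laws without moments. -/
theorem lintegral_iterate_syncStep_le [IsProbabilityMeasure ν] (hp : IsEquivNorm p C)
    (hT : IsContractive p γ T) (hα : 0 < α) (hα' : α ≤ 1) {g : ℝ → ℝ≥0∞} (hg : Monotone g)
    (n : ℕ) (ξ : Measure (E × E)) [SFinite ξ] :
    ∫⁻ z, g (p (z.1 - z.2)) ∂((syncStep T ν α)^[n] ξ) ≤
      ∫⁻ z, g ((1 - α * (1 - γ)) ^ n * p (z.1 - z.2)) ∂ξ := by
  have hpm : Measurable p := hp.continuous.measurable
  have hρ := (hT.rate_mem hα hα').1.le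
  induction n generalizing ξ with
  | zero => simp
  | succ n ih =>
    rw [Function.iterate_succ_apply]
    refine (ih _).trans ?_
    have hm : Measurable fun z : E × E => g ((1 - α * (1 - γ)) ^ n * p (z.1 - z.2)) :=
      hg.measurable.comp (by fun_prop)
    rw [syncStep, lintegral_map hm (measurable_saStep_pair (hT.continuous hp) α)]
    have hm' : Measurable fun z : E × E => g ((1 - α * (1 - γ)) ^ (n + 1) * p (z.1 - z.2)) :=
      hg.measurable.comp (by fun_prop)
    calc _ ≤ ∫⁻ z, g ((1 - α * (1 - γ)) ^ (n + 1) * p (z.1.1 - z.1.2)) ∂(ξ.prod ν) := by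
          refine lintegral_mono fun z => hg ?_
          rw [pow_succ, mul_assoc]
          gcongr
          exact hT.saStep_sub_le hα hα' _ _ _
      _ = _ := by
          rw [← (measurePreserving_fst (μ := ξ) (ν := ν)).lintegral_comp hm']

end NormedSpace

/-! ### Uniqueness of the stationary law -/

section InnerProductSpace

theorem enorm_exp_inner_sub_le {E : Type*} [NormedAddCommGroup E] [InnerProductSpace ℝ E]
    {p : Seminorm ℝ E} {C : ℝ} (hp : IsEquivNorm p C) (t x y : E) :
    ‖Complex.exp (inner ℝ x t * Complex.I) - Complex.exp (inner ℝ y t * Complex.I)‖ₑ ≤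
      min 2 (ENNReal.ofReal (‖t‖ * C * p (x - y))) := by
  refine le_min ?_ ?_
  · refine (enorm_sub_le).trans ?_
    rw [← ofReal_norm, ← ofReal_norm, Complex.norm_exp_ofReal_mul_I,
      Complex.norm_exp_ofReal_mul_I]
    norm_num
  · rw [← ofReal_norm]
    refine ENNReal.ofReal_le_ofReal ?_
    have h : Complex.exp (inner ℝ x t * Complex.I) - Complex.exp (inner ℝ y t * Complex.I) =
        Complex.exp (inner ℝ y t * Complex.I) *
          (Complex.exp (Complex.I * (inner ℝ (x - y) t : ℝ)) - 1) := by
      rw [mul_sub, ← Complex.exp_add, inner_sub_left]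
      push_cast
      ring_nf
    rw [h, norm_mul, Complex.norm_exp_ofReal_mul_I, one_mul]
    refine (Real.norm_exp_I_mul_ofReal_sub_one_le).trans ?_
    refine (norm_inner_le_norm _ _).trans ?_
    nlinarith [mul_le_mul_of_nonneg_left (hp.norm_le (x - y)) (norm_nonneg t)]

variable {E : Type*} [NormedAddCommGroup E] [InnerProductSpace ℝ E] [CompleteSpace E]
  [MeasurableSpace E] [BorelSpace E] [SecondCountableTopology E]
  {p : Seminorm ℝ E} {C γ α : ℝ} {T : E → E} {ν : Measure E}

/-- Two stationary laws, coupled arbitrarily and then run synchronously, keep their laws while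
their distance tends to zero; hence their characteristic functions agree. -/
theorem invariant_unique [IsProbabilityMeasure ν] (hp : IsEquivNorm p C)
    (hT : IsContractive p γ T) (hα : 0 < α) (hα' : α ≤ 1) {π π' : Measure E}
    [IsProbabilityMeasure π] [IsProbabilityMeasure π']
    (hπ : Kernel.Invariant (saKernel T ν α) π) (hπ' : Kernel.Invariant (saKernel T ν α) π') :
    π' = π := by
  have hTc := hT.continuous hp
  rw [invariant_saKernel_iff hTc] at hπ hπ'
  refine Measure.ext_of_charFun (funext fun t => ?_)
  set ξ : ℕ → Measure (E × E) := fun n => (syncStep T ν α)^[n] (π'.prod π) with hξ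
  have hfst n : (ξ n).fst = π' :=
    fst_iterate_syncStep hTc (μ := fun _ => π') (by simp) (fun _ => hπ') n
  have hsnd n : (ξ n).snd = π :=
    snd_iterate_syncStep hTc (μ := fun _ => π) (by simp) (fun _ => hπ) n
  have hprob n : IsProbabilityMeasure (ξ n) := by
    refine ⟨?_⟩
    rw [← Measure.fst_univ, hfst, measure_univ]
  set g : ℝ → ℝ≥0∞ := fun r => min 2 (ENNReal.ofReal (‖t‖ * C * r)) with hg
  have hC := hp.pos
  have hpm : Measurable p := hp.continuous.measurable
  have hgm : Monotone g := fun a b hab => by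
    simp only [hg]
    gcongr
  obtain ⟨hρ0, hρ1⟩ := hT.rate_mem hα hα'
  have hbound n : ‖charFun π' t - charFun π t‖ₑ ≤
      ∫⁻ z, g ((1 - α * (1 - γ)) ^ n * p (z.1 - z.2)) ∂(π'.prod π) := by
    have hint (μ : Measure (E × E)) [IsProbabilityMeasure μ] (f : E × E → E) (hf : Measurable f) :
        Integrable (fun z => Complex.exp (inner ℝ (f z) t * Complex.I)) μ := by
      refine Integrable.of_bound (C := 1) (by fun_prop) ?_
      exact Filter.Eventually.of_forall fun z => (Complex.norm_exp_ofReal_mul_I _).le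
    have hexpm : Measurable fun x : E => Complex.exp (inner ℝ x t * Complex.I) := by fun_prop
    have h₁ : charFun π' t = ∫ z, Complex.exp (inner ℝ z.1 t * Complex.I) ∂(ξ n) := by
      conv_lhs => rw [← hfst n]
      rw [charFun_apply, Measure.fst, integral_map (by fun_prop) hexpm.aestronglyMeasurable]
    have h₂ : charFun π t = ∫ z, Complex.exp (inner ℝ z.2 t * Complex.I) ∂(ξ n) := by
      conv_lhs => rw [← hsnd n]
      rw [charFun_apply, Measure.snd, integral_map (by fun_prop) hexpm.aestronglyMeasurable]
    rw [h₁, h₂, ← integral_sub (hint _ _ measurable_fst) (hint _ _ measurable_snd)]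
    refine (enorm_integral_le_lintegral_enorm _).trans ?_
    have h₃ : ∫⁻ z, g (p (z.1 - z.2)) ∂(ξ n) ≤
        ∫⁻ z, g ((1 - α * (1 - γ)) ^ n * p (z.1 - z.2)) ∂(π'.prod π) :=
      lintegral_iterate_syncStep_le (ν := ν) (T := T) (ξ := π'.prod π) hp hT hα hα' hgm n
    refine le_trans (lintegral_mono (g := fun z => g (p (z.1 - z.2))) fun z => ?_) h₃
    exact enorm_exp_inner_sub_le hp t z.1 z.2
  have hlim : Filter.Tendsto
      (fun n => ∫⁻ z, g ((1 - α * (1 - γ)) ^ n * p (z.1 - z.2)) ∂(π'.prod π))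
      Filter.atTop (nhds (∫⁻ _, 0 ∂(π'.prod π))) := by
    refine tendsto_lintegral_of_dominated_convergence (fun _ => 2)
      (fun n => hgm.measurable.comp (by fun_prop))
      (fun n => Filter.Eventually.of_forall fun z => min_le_left _ _) (by simp)
      (Filter.Eventually.of_forall fun z => ?_)
    have h1 : Filter.Tendsto (fun n : ℕ => ‖t‖ * C * ((1 - α * (1 - γ)) ^ n * p (z.1 - z.2)))
        Filter.atTop (nhds 0) := by
      simpa using ((tendsto_pow_atTop_nhds_zero_of_lt_one hρ0.le hρ1).mul_const
        (p (z.1 - z.2))).const_mul (‖t‖ * C)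
    have h2 := (ENNReal.tendsto_ofReal h1)
    rw [ENNReal.ofReal_zero] at h2
    exact tendsto_of_tendsto_of_tendsto_of_le_of_le tendsto_const_nhds h2 (fun _ => zero_le)
      (fun _ => min_le_right _ _)
  rw [lintegral_zero] at hlim
  have h0 : ‖charFun π' t - charFun π t‖ₑ ≤ 0 := ge_of_tendsto' hlim hbound
  simpa [sub_eq_zero] using h0

end InnerProductSpace


/-! ### Stationary solutions of the recursion -/

section NormedSpace

variable {E : Type*} [NormedAddCommGroup E] [NormedSpace ℝ E] {p : Seminorm ℝ E} {C γ α : ℝ}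
  {T : E → E} {Ω : Type*} [MeasurableSpace Ω] {P : Measure Ω}

theorem IsEquivNorm.memLp_comp (hp : IsEquivNorm p C) {X : Ω → E} (hX : MemLp X 2 P) :
    MemLp (fun ω => p (X ω)) 2 P :=
  hX.of_le_mul (c := C) (hp.continuous.comp_aestronglyMeasurable hX.1) <|
    Filter.Eventually.of_forall fun ω => by
      rw [Real.norm_of_nonneg (apply_nonneg p _)]
      exact hp.le_norm _

theorem memLp_saStep [IsFiniteMeasure P] (hp : IsEquivNorm p C) (hT : IsContractive p γ T)
    {X V : Ω → E} (hX : MemLp X 2 P) (hV : MemLp V 2 P) :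
    MemLp (fun ω => saStep T α (X ω) (V ω)) 2 P := by
  have h0 : MemLp (fun ω => T (X ω) - T 0) 2 P := by
    refine hX.of_le_mul (c := C * (γ * C)) ?_ (Filter.Eventually.of_forall fun ω => ?_)
    · exact ((hT.continuous hp).comp_aestronglyMeasurable hX.1).sub aestronglyMeasurable_const
    · have hC := hp.pos
      have hγ := hT.1
      calc ‖T (X ω) - T 0‖ ≤ C * p (T (X ω) - T 0) := hp.norm_le _
        _ ≤ C * (γ * (C * ‖X ω‖)) := by
          gcongr
          refine (hT.2.2 _ _).trans ?_
          rw [sub_zero]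
          gcongr
          exact hp.le_norm _
        _ = _ := by ring
  have h1 : MemLp (fun ω => T (X ω)) 2 P := by
    exact (h0.add (memLp_const (T 0))).ae_eq (Filter.Eventually.of_forall fun ω => by simp)
  exact hX.add (((h1.sub hX).add hV).const_smul α)

/-- For noise `W` and a measure preserving shift `S`, the recursion has a square integrable
stationary solution. It is the fixed point in `L²` of the map `X ↦ saStep T α (X ∘ S) W`: this map
is a contraction for `‖p ∘ X‖₂`, so one of its iterates is a contraction for the equivalent norm
of `L²`. -/
theorem exists_stationary_solution [CompleteSpace E] [IsFiniteMeasure P] (hp : IsEquivNorm p C)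
    (hT : IsContractive p γ T) (hα : 0 < α) (hα' : α ≤ 1) {S : Ω → Ω}
    (hS : MeasurePreserving S P P) {W : Ω → E} (hW : MemLp W 2 P) :
    ∃ X : Ω → E, StronglyMeasurable X ∧ MemLp X 2 P ∧
      ∀ᵐ ω ∂P, X ω = saStep T α (X (S ω)) (W ω) := by
  obtain ⟨hρ0, hρ1⟩ := hT.rate_mem hα hα'
  set ρ := 1 - α * (1 - γ)
  have hC := hp.pos
  have hmem (X : Lp E 2 P) : MemLp (fun ω => saStep T α (X (S ω)) (W ω)) 2 P :=
    memLp_saStep hp hT ((Lp.memLp X).comp_measurePreserving hS) hW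
  let Φ : Lp E 2 P → Lp E 2 P := fun X => (hmem X).toLp _
  have hΦ (X : Lp E 2 P) : Φ X =ᵐ[P] fun ω => saStep T α (X (S ω)) (W ω) := (hmem X).coeFn_toLp
  let N : Lp E 2 P → Lp E 2 P → ℝ≥0∞ := fun X Y => eLpNorm (fun ω => p (X ω - Y ω)) 2 P
  have hstep (X Y : Lp E 2 P) : N (Φ X) (Φ Y) ≤ ENNReal.ofReal ρ * N X Y := by
    have hae : ∀ᵐ ω ∂P, ‖p (Φ X ω - Φ Y ω)‖ ≤ ρ * ‖p (X (S ω) - Y (S ω))‖ := by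
      filter_upwards [hΦ X, hΦ Y] with ω h1 h2
      rw [h1, h2, Real.norm_of_nonneg (apply_nonneg p _), Real.norm_of_nonneg (apply_nonneg p _)]
      exact hT.saStep_sub_le hα hα' _ _ _
    refine (eLpNorm_le_mul_eLpNorm_of_ae_le_mul hae 2).trans_eq ?_
    congr 1
    exact eLpNorm_comp_measurePreserving (g := fun ω => p (X ω - Y ω))
      (hp.memLp_comp ((Lp.memLp X).sub (Lp.memLp Y))).1 hS
  have hiter (n : ℕ) (X Y : Lp E 2 P) :
      N (Φ^[n] X) (Φ^[n] Y) ≤ ENNReal.ofReal (ρ ^ n) * N X Y := by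
    induction n generalizing X Y with
    | zero => simp
    | succ n ih =>
      rw [Function.iterate_succ_apply, Function.iterate_succ_apply, pow_succ,
        ENNReal.ofReal_mul (by positivity), mul_assoc]
      exact (ih _ _).trans (by gcongr; exact hstep X Y)
  have hle (X Y : Lp E 2 P) : edist X Y ≤ ENNReal.ofReal C * N X Y := by
    rw [Lp.edist_def]
    refine eLpNorm_le_mul_eLpNorm_of_ae_le_mul (Filter.Eventually.of_forall fun ω => ?_) 2
    rw [Real.norm_of_nonneg (apply_nonneg p _)]
    exact hp.norm_le _
  have hge (X Y : Lp E 2 P) : N X Y ≤ ENNReal.ofReal C * edist X Y := by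
    rw [Lp.edist_def]
    refine eLpNorm_le_mul_eLpNorm_of_ae_le_mul (Filter.Eventually.of_forall fun ω => ?_) 2
    rw [Real.norm_of_nonneg (apply_nonneg p _)]
    exact hp.le_norm _
  obtain ⟨n, hn⟩ : ∃ n : ℕ, C * (ρ ^ n * C) < 1 := by
    have h : Filter.Tendsto (fun n : ℕ => C * (ρ ^ n * C)) Filter.atTop (nhds 0) := by
      simpa using ((tendsto_pow_atTop_nhds_zero_of_lt_one hρ0.le hρ1).mul_const C).const_mul C
    exact (h.eventually (gt_mem_nhds one_pos)).exists
  have hcontr : ContractingWith (C * (ρ ^ n * C)).toNNReal Φ^[n] := by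
    refine ⟨by simpa using hn, fun X Y => ?_⟩
    calc edist (Φ^[n] X) (Φ^[n] Y) ≤ ENNReal.ofReal C * N (Φ^[n] X) (Φ^[n] Y) := hle _ _
      _ ≤ ENNReal.ofReal C * (ENNReal.ofReal (ρ ^ n) * (ENNReal.ofReal C * edist X Y)) := by
        gcongr
        exact (hiter n X Y).trans (by gcongr; exact hge X Y)
      _ = ENNReal.ofReal (C * (ρ ^ n * C)) * edist X Y := by
        rw [ENNReal.ofReal_mul hC.le, ENNReal.ofReal_mul (by positivity)]
        ring
  have hfix := hcontr.isFixedPt_fixedPoint_iterate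
  set X := ContractingWith.fixedPoint Φ^[n] hcontr
  refine ⟨X, Lp.stronglyMeasurable X, Lp.memLp X, ?_⟩
  have h := hΦ X
  rwa [hfix.eq] at h

/-- The law of a stationary solution is a stationary law of the chain, if the present noise value
`W` is independent of the shift `S`, that is, of the past. -/
theorem invariant_map_of_stationary_solution [IsProbabilityMeasure P] [MeasurableSpace E]
    [BorelSpace E] [SecondCountableTopology E] {ν : Measure E} [IsProbabilityMeasure ν]
    (hT : Continuous T) {S : Ω → Ω} {W : Ω → E}
    (hSW : MeasurePreserving (fun ω => (S ω, W ω)) P (P.prod ν)) {X : Ω → E} (hX : Measurable X)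
    (hXeq : ∀ᵐ ω ∂P, X ω = saStep T α (X (S ω)) (W ω)) :
    Kernel.Invariant (saKernel T ν α) (P.map X) := by
  have := Measure.isProbabilityMeasure_map (μ := P) hX.aemeasurable
  have hprod : (P.map X).prod ν = P.map (fun ω => (X (S ω), W ω)) := by
    conv_lhs => rw [← Measure.map_id (μ := ν)]
    rw [Measure.map_prod_map _ _ hX measurable_id, ← hSW.map_eq,
      Measure.map_map (hX.prodMap measurable_id) hSW.measurable]
    rfl
  have hm : Measurable fun ω => (X (S ω), W ω) :=
    (hX.comp (measurable_fst.comp hSW.measurable)).prodMk (measurable_snd.comp hSW.measurable)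
  rw [invariant_saKernel_iff hT, hprod, Measure.map_map (measurable_saStep hT α) hm]
  exact (Measure.map_congr hXeq).symm

end NormedSpace

/-! ### The mean square error -/

section MeanSquare

variable {E : Type*} [NormedAddCommGroup E] [InnerProductSpace ℝ E]
  {p : Seminorm ℝ E} {C γ α : ℝ} {T : E → E} {Ω : Type*} [MeasurableSpace Ω] {P : Measure Ω}

/-- The stationary solution of the linear recursion, that is, of the one with `T = 0`, has second
moment of order `α`: in `‖(1 - α) Z' + α W‖²` the cross term has mean zero. -/
theorem integral_norm_sq_linear_le [CompleteSpace E] [IsProbabilityMeasure P]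
    [MeasurableSpace E] [BorelSpace E]
    (hα : 0 < α) (hα' : α ≤ 1) {S : Ω → Ω} (hS : MeasurePreserving S P P) {W Z : Ω → E}
    (hW : MemLp W 2 P) (hW0 : ∫ ω, W ω ∂P = 0) (hZ : MemLp Z 2 P)
    (hind : IndepFun (fun ω => Z (S ω)) W P)
    (hZeq : ∀ᵐ ω ∂P, Z ω = saStep (fun _ => 0) α (Z (S ω)) (W ω)) :
    ∫ ω, ‖Z ω‖ ^ 2 ∂P ≤ α * ∫ ω, ‖W ω‖ ^ 2 ∂P := by
  have hZS : MemLp (fun ω => Z (S ω)) 2 P := hZ.comp_measurePreserving hS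
  have hcross : ∫ ω, inner ℝ (Z (S ω)) (W ω) ∂P = 0 := by
    have h := hind.integral_bilin (hZS.integrable one_le_two) (hW.integrable one_le_two)
      (innerSL ℝ)
    rw [hW0, map_zero] at h
    exact h
  have hsq : ∫ ω, ‖Z (S ω)‖ ^ 2 ∂P = ∫ ω, ‖Z ω‖ ^ 2 ∂P := by
    have h : AEStronglyMeasurable (fun ω => ‖Z ω‖ ^ 2) (P.map S) := by
      rw [hS.map_eq]
      exact hZ.1.norm.pow 2
    rw [← integral_map hS.measurable.aemeasurable h, hS.map_eq]
  have hexp : ∫ ω, ‖Z ω‖ ^ 2 ∂P = ∫ ω, ((1 - α) ^ 2 * ‖Z (S ω)‖ ^ 2 +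
      2 * ((1 - α) * α) * inner ℝ (Z (S ω)) (W ω) + α ^ 2 * ‖W ω‖ ^ 2) ∂P := by
    refine integral_congr_ae ?_
    filter_upwards [hZeq] with ω h
    have h' : Z ω = (1 - α) • Z (S ω) + α • W ω := by
      rw [h]; unfold saStep; module
    rw [h', norm_add_sq_real, norm_smul, norm_smul, inner_smul_left, inner_smul_right, mul_pow,
      mul_pow, Real.norm_eq_abs, Real.norm_eq_abs, sq_abs, sq_abs]
    simp only [conj_trivial]
    ring
  have i1 : Integrable (fun ω => ‖Z (S ω)‖ ^ 2) P := hZS.integrable_norm_pow two_ne_zero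
  have i2 : Integrable (fun ω => inner ℝ (Z (S ω)) (W ω)) P :=
    hind.integrable_bilin (hZS.integrable one_le_two) (hW.integrable one_le_two) (innerSL ℝ)
  have i3 : Integrable (fun ω => ‖W ω‖ ^ 2) P := hW.integrable_norm_pow two_ne_zero
  have i12 : Integrable (fun ω => (1 - α) ^ 2 * ‖Z (S ω)‖ ^ 2 +
      2 * ((1 - α) * α) * inner ℝ (Z (S ω)) (W ω)) P := (i1.const_mul _).add (i2.const_mul _)
  rw [integral_add i12 (i3.const_mul _),
    integral_add (i1.const_mul _) (i2.const_mul _), integral_const_mul, integral_const_mul,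
    integral_const_mul, hcross, hsq] at hexp
  have hm : 0 ≤ ∫ ω, ‖Z ω‖ ^ 2 ∂P := integral_nonneg fun _ => by positivity
  have h2 : α * ((2 - α) * ∫ ω, ‖Z ω‖ ^ 2 ∂P) = α * (α * ∫ ω, ‖W ω‖ ^ 2 ∂P) := by linarith
  nlinarith [mul_left_cancel₀ hα.ne' h2]

/-- The deviation `X - θ⋆` of a stationary solution is controlled by the solution `Z` of the linear
recursion with the same noise: the remainder `U = X - θ⋆ - Z` sees the noise only through `Z`, and
satisfies `p U ≤ (1 - α (1 - γ)) p U' + α γ p Z'`. -/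
theorem integral_norm_sub_sq_le [IsProbabilityMeasure P] (hp : IsEquivNorm p C)
    (hT : IsContractive p γ T) (hα : 0 < α) (hα' : α ≤ 1) {θ : E} (hθ : T θ = θ) {S : Ω → Ω}
    (hS : MeasurePreserving S P P) {W X Z : Ω → E} (hX : MemLp X 2 P) (hZ : MemLp Z 2 P)
    (hXeq : ∀ᵐ ω ∂P, X ω = saStep T α (X (S ω)) (W ω))
    (hZeq : ∀ᵐ ω ∂P, Z ω = saStep (fun _ => 0) α (Z (S ω)) (W ω)) :
    ∫ ω, ‖X ω - θ‖ ^ 2 ∂P ≤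
      (2 * (C ^ 2 * (γ / (1 - γ))) ^ 2 + 2) * ∫ ω, ‖Z ω‖ ^ 2 ∂P := by
  obtain ⟨hγ0, hγ1, hTγ⟩ := hT
  have hγ' : 0 < 1 - γ := by linarith
  set κ := γ / (1 - γ) with hκ
  have hκγ : (1 - γ) * κ = γ := by rw [hκ]; field_simp
  set U : Ω → E := fun ω => X ω - θ - Z ω with hU
  have hUm : MemLp U 2 P := (hX.sub (memLp_const θ)).sub hZ
  have hpt : ∀ᵐ ω ∂P, p (U ω) ≤ (1 - α * (1 - γ)) * p (U (S ω)) + α * γ * p (Z (S ω)) := by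
    filter_upwards [hXeq, hZeq] with ω h1 h2
    have h : U ω = (1 - α) • U (S ω) + α • (T (X (S ω)) - T θ) := by
      simp only [hU]
      rw [h1, h2, hθ]
      unfold saStep
      module
    have h3 : p (X (S ω) - θ) ≤ p (U (S ω)) + p (Z (S ω)) := by
      have : X (S ω) - θ = U (S ω) + Z (S ω) := by simp only [hU]; abel
      rw [this]
      exact map_add_le_add p _ _
    have h4 : p (T (X (S ω)) - T θ) ≤ γ * (p (U (S ω)) + p (Z (S ω))) :=
      (hTγ _ _).trans (by gcongr)
    rw [h]
    refine (map_add_le_add p _ _).trans ?_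
    rw [map_smul_eq_mul, map_smul_eq_mul, Real.norm_of_nonneg (by linarith),
      Real.norm_of_nonneg hα.le]
    nlinarith [mul_le_mul_of_nonneg_left h4 hα.le]
  -- As `α γ = α (1 - γ) κ`, the right side is a convex combination of `p U'` and `κ p Z'`.
  have hpt2 : ∀ᵐ ω ∂P, p (U ω) ^ 2 ≤
      (1 - α * (1 - γ)) * p (U (S ω)) ^ 2 + α * (1 - γ) * κ ^ 2 * p (Z (S ω)) ^ 2 := by
    filter_upwards [hpt] with ω h
    set a := p (U (S ω))
    set b := κ * p (Z (S ω)) with hb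
    have h' : p (U ω) ≤ (1 - α * (1 - γ)) * a + α * (1 - γ) * b := by
      have : α * (1 - γ) * b = α * γ * p (Z (S ω)) := by
        rw [hb]; linear_combination α * p (Z (S ω)) * hκγ
      rwa [this]
    have hs : 0 ≤ α * (1 - γ) * (1 - α * (1 - γ)) := by
      have : 0 ≤ 1 - α * (1 - γ) := by nlinarith
      positivity
    calc p (U ω) ^ 2 ≤ ((1 - α * (1 - γ)) * a + α * (1 - γ) * b) ^ 2 := by
          have := apply_nonneg p (U ω)
          gcongr
      _ ≤ (1 - α * (1 - γ)) * a ^ 2 + α * (1 - γ) * b ^ 2 := by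
          nlinarith [mul_nonneg hs (sq_nonneg (a - b))]
      _ = _ := by rw [hb]; ring
  have hshift {f : Ω → E} (hf : MemLp f 2 P) :
      Integrable (fun ω => p (f (S ω)) ^ 2) P ∧
        ∫ ω, p (f (S ω)) ^ 2 ∂P = ∫ ω, p (f ω) ^ 2 ∂P := by
    have hm := (hp.memLp_comp hf)
    refine ⟨(hm.comp_measurePreserving hS).integrable_sq, ?_⟩
    have h : AEStronglyMeasurable (fun ω => p (f ω) ^ 2) (P.map S) := by
      rw [hS.map_eq]
      exact hm.1.pow 2
    rw [← integral_map hS.measurable.aemeasurable h, hS.map_eq]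
  have hA : ∫ ω, p (U ω) ^ 2 ∂P ≤ κ ^ 2 * ∫ ω, p (Z ω) ^ 2 ∂P := by
    have h := integral_mono_ae (hp.memLp_comp hUm).integrable_sq
      (((hshift hUm).1.const_mul _).add ((hshift hZ).1.const_mul _)) hpt2
    simp only [Pi.add_apply] at h
    rw [integral_add ((hshift hUm).1.const_mul _) ((hshift hZ).1.const_mul _),
      integral_const_mul, integral_const_mul, (hshift hUm).2, (hshift hZ).2] at h
    have h' : α * (1 - γ) * ∫ ω, p (U ω) ^ 2 ∂P ≤
        α * (1 - γ) * (κ ^ 2 * ∫ ω, p (Z ω) ^ 2 ∂P) := by linarith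
    exact le_of_mul_le_mul_left h' (by positivity)
  have hZsq : Integrable (fun ω => ‖Z ω‖ ^ 2) P := hZ.integrable_norm_pow two_ne_zero
  have hB : ∫ ω, p (Z ω) ^ 2 ∂P ≤ C ^ 2 * ∫ ω, ‖Z ω‖ ^ 2 ∂P := by
    rw [← integral_const_mul]
    refine integral_mono (hp.memLp_comp hZ).integrable_sq (hZsq.const_mul _) fun ω => ?_
    dsimp only
    rw [← mul_pow]
    have := apply_nonneg p (Z ω)
    gcongr
    exact hp.le_norm _
  have hD : ∫ ω, ‖X ω - θ‖ ^ 2 ∂P ≤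
      2 * C ^ 2 * ∫ ω, p (U ω) ^ 2 ∂P + 2 * ∫ ω, ‖Z ω‖ ^ 2 ∂P := by
    rw [← integral_const_mul, ← integral_const_mul,
      ← integral_add ((hp.memLp_comp hUm).integrable_sq.const_mul _) (hZsq.const_mul _)]
    refine integral_mono ((hX.sub (memLp_const θ)).integrable_norm_pow two_ne_zero)
      (((hp.memLp_comp hUm).integrable_sq.const_mul _).add (hZsq.const_mul _)) fun ω => ?_
    have h1 : ‖X ω - θ‖ ≤ ‖U ω‖ + ‖Z ω‖ := by
      have : X ω - θ = U ω + Z ω := by simp only [hU]; abel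
      rw [this]
      exact norm_add_le _ _
    have h2 : ‖U ω‖ ^ 2 ≤ C ^ 2 * p (U ω) ^ 2 := by
      rw [← mul_pow]
      gcongr
      exact hp.norm_le _
    have h3 : ‖X ω - θ‖ ^ 2 ≤ (‖U ω‖ + ‖Z ω‖) ^ 2 := by gcongr
    dsimp only
    nlinarith [sq_nonneg (‖U ω‖ - ‖Z ω‖)]
  calc _ ≤ 2 * C ^ 2 * (κ ^ 2 * (C ^ 2 * ∫ ω, ‖Z ω‖ ^ 2 ∂P)) + 2 * ∫ ω, ‖Z ω‖ ^ 2 ∂P := by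
        refine hD.trans ?_
        gcongr
        exact hA.trans (by gcongr)
    _ = _ := by ring

end MeanSquare


/-! ### Independence of past and future -/

section Independence

variable {Ω : Type*} [MeasurableSpace Ω] {P : Measure Ω}

theorem indepFun_zero_tail {E : Type*} [MeasurableSpace E] {w : ℕ → Ω → E}
    (hm : ∀ n, Measurable (w n)) (hw : iIndepFun w P) :
    IndepFun (w 0) (fun ω n => w (n + 1) ω) P := by
  have := hw.isProbabilityMeasure
  refine IndepFun.indepFun_process (hm 0) (fun n => hm (n + 1)) fun I => ?_
  have hdisj : Disjoint ({0} : Finset ℕ) (I.image Nat.succ) := by simp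
  have h := hw.indepFun_finset _ _ hdisj hm
  have hφ : Measurable fun x : (({0} : Finset ℕ) → E) => x ⟨0, by simp⟩ := measurable_pi_apply _
  have hψ : Measurable fun (x : (I.image Nat.succ → E)) (i : I) =>
      x ⟨i.1 + 1, Finset.mem_image_of_mem _ i.2⟩ :=
    measurable_pi_lambda _ fun _ => measurable_pi_apply _
  exact h.comp hφ hψ

theorem indepFun_prodMk_left {α β δ : Type*} [MeasurableSpace α] [MeasurableSpace β]
    [MeasurableSpace δ] [IsProbabilityMeasure P] {X : Ω → α} {A : Ω → β} {B : Ω → δ}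
    (hX : Measurable X) (hA : Measurable A) (hB : Measurable B)
    (h : IndepFun X (fun ω => (A ω, B ω)) P) (hAB : IndepFun A B P) :
    IndepFun (fun ω => (X ω, A ω)) B P := by
  have hXA : IndepFun X A P := h.comp measurable_id measurable_fst
  rw [indepFun_iff_map_prod_eq_prod_map_map (by fun_prop) (by fun_prop)] at h hAB hXA ⊢
  have e : (fun ω => ((X ω, A ω), B ω)) =
      MeasurableEquiv.prodAssoc.symm ∘ fun ω => (X ω, (A ω, B ω)) := rfl
  rw [e, ← Measure.map_map (by fun_prop) (by fun_prop), h, hAB, hXA,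
    ← Measure.prodAssoc_prod, MeasurableEquiv.map_symm_map]

/-- On the space of noise sequences, the shifted sequence and the first noise value are
independent, and the shift preserves the product measure. -/
theorem measurePreserving_shift_prodMk_zero {E : Type*} [MeasurableSpace E] (ν : Measure E)
    [IsProbabilityMeasure ν] :
    MeasurePreserving (fun w : ℕ → E => (fun n => w (n + 1), w 0))
      (Measure.infinitePi fun _ => ν) ((Measure.infinitePi fun _ => ν).prod ν) := by
  have hind : iIndepFun (fun (n : ℕ) (w : ℕ → E) => w n) (Measure.infinitePi fun _ => ν) :=
    iIndepFun_infinitePi (P := fun _ => ν) (X := fun _ x => x) fun _ => measurable_id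
  refine ⟨by fun_prop, ?_⟩
  have h := (indepFun_zero_tail (fun n => measurable_pi_apply n) hind).symm
  have hsm : Measurable fun (w : ℕ → E) n => w (n + 1) := by fun_prop
  have h0m : Measurable fun w : ℕ → E => w 0 := by fun_prop
  rw [indepFun_iff_map_prod_eq_prod_map_map hsm.aemeasurable h0m.aemeasurable] at h
  have h2 : (Measure.infinitePi fun _ => ν).map (fun (w : ℕ → E) n => w (n + 1)) =
      Measure.infinitePi fun _ => ν := by
    have := (hind.precomp (g := fun n => n + 1) (add_left_injective 1)).map_fun_eq_infinitePi_map
      (fun n => measurable_pi_apply _)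
    simpa [Function.comp_def, Measure.infinitePi_map_eval] using! this
  rw [h, h2, Measure.infinitePi_map_eval]

end Independence

variable {E : Type*} [MeasurableSpace E]

section Iterates

variable [NormedAddCommGroup E] [NormedSpace ℝ E] [BorelSpace E] [SecondCountableTopology E]
  {T : E → E} {ν : Measure E} {α : ℝ} {Ω : Type*} [MeasurableSpace Ω] {P : Measure Ω}
  {w θ : ℕ → Ω → E}

theorem IsSAProcess.measurable (h : IsSAProcess P T ν α w θ) (hT : Continuous T) (t : ℕ) :
    Measurable (θ t) := by
  induction t with
  | zero => exact h.measurable_init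
  | succ t ih =>
    rw [funext (h.step t)]
    exact (measurable_saStep hT α).comp (ih.prodMk (h.measurable_noise t))

/-- The iterate at time `t` is independent of the noise from time `t` on. -/
theorem IsSAProcess.indepFun_future [IsProbabilityMeasure P] (h : IsSAProcess P T ν α w θ)
    (hT : Continuous T) (t : ℕ) :
    IndepFun (θ t) (fun ω n => w (n + t) ω) P := by
  have hw := h.measurable_noise
  induction t with
  | zero => exact h.indep_init
  | succ t ih =>
    -- `θ (t + 1)` is a function of `(θ t, w t)`, which is independent of the later noise.
    have htail : IndepFun (w t) (fun ω n => w (n + 1 + t) ω) P := by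
      have := indepFun_zero_tail (w := fun n => w (n + t)) (fun n => hw _)
        (h.indep_noise.precomp (add_left_injective t))
      simpa using! this
    have hpair : IndepFun (θ t) (fun ω => (w t ω, fun n => w (n + 1 + t) ω)) P := by
      have hψ : Measurable fun x : ℕ → E => (x 0, fun n => x (n + 1)) := by fun_prop
      simpa [Function.comp_def] using! ih.comp measurable_id hψ
    have hfut : Measurable fun ω n => w (n + 1 + t) ω := measurable_pi_lambda _ fun _ => hw _
    have hind := indepFun_prodMk_left (h.measurable hT t) (hw t) hfut hpair htail
    rw [funext (h.step t)]
    have := hind.comp (measurable_saStep hT α) measurable_id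
    simpa [Function.comp_def, add_assoc, add_comm 1 t] using! this

theorem IsSAProcess.map_succ [IsProbabilityMeasure P] (h : IsSAProcess P T ν α w θ)
    (hT : Continuous T) (t : ℕ) :
    ((P.map (θ t)).prod ν).map (fun z => saStep T α z.1 z.2) = P.map (θ (t + 1)) := by
  have hθ := h.measurable hT t
  have hw := h.measurable_noise t
  have hind : IndepFun (θ t) (w t) P := by
    simpa [Function.comp_def] using!
      (h.indepFun_future hT t).comp measurable_id (measurable_pi_apply 0)
  rw [indepFun_iff_map_prod_eq_prod_map_map (by fun_prop) (by fun_prop), h.law_noise] at hind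
  rw [← hind, Measure.map_map (measurable_saStep hT α) (hθ.prodMk hw), funext (h.step t)]
  rfl

end Iterates

/-! ### Convergence in Wasserstein distance -/

theorem W2_sq_le [AddCommGroup E] [Module ℝ E] (p : Seminorm ℝ E) {μ ν : Measure E}
    {ξ : Measure (E × E)} (h₁ : ξ.fst = μ) (h₂ : ξ.snd = ν) :
    W2 p μ ν ^ 2 ≤ ∫⁻ z, ENNReal.ofReal (p (z.1 - z.2)) ^ 2 ∂ξ := by
  have h : W2 p μ ν ≤ (∫⁻ z, ENNReal.ofReal (p (z.1 - z.2)) ^ 2 ∂ξ) ^ (1 / 2 : ℝ) :=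
    iInf₂_le ξ ⟨h₁, h₂⟩
  calc _ ≤ ((∫⁻ z, ENNReal.ofReal (p (z.1 - z.2)) ^ 2 ∂ξ) ^ (1 / 2 : ℝ)) ^ 2 := by gcongr
    _ = _ := by
      rw [← ENNReal.rpow_natCast, ← ENNReal.rpow_mul]
      norm_num

variable [NormedAddCommGroup E] [SecondCountableTopology E]
  {C γ α : ℝ} {T : E → E} {ν : Measure E} [IsProbabilityMeasure ν]

/-- The cost of the independent coupling. -/
theorem lintegral_prod_ofReal_sq_le [NormedSpace ℝ E] {p : Seminorm ℝ E} (hp : IsEquivNorm p C)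
    {μ π : Measure E} [IsProbabilityMeasure μ] [IsProbabilityMeasure π] (hμ : MemLp id 2 μ)
    (hπ : MemLp id 2 π) :
    ∫⁻ z, ENNReal.ofReal (p (z.1 - z.2)) ^ 2 ∂(μ.prod π) ≤
      ENNReal.ofReal (2 * C ^ 2 * (∫ x, ‖x‖ ^ 2 ∂μ + ∫ x, ‖x‖ ^ 2 ∂π)) := by
  have h1 : Integrable (fun x => ‖x‖ ^ 2) μ := hμ.integrable_norm_pow two_ne_zero
  have h2 : Integrable (fun x => ‖x‖ ^ 2) π := hπ.integrable_norm_pow two_ne_zero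
  have i1 : Integrable (fun z : E × E => ‖z.1‖ ^ 2) (μ.prod π) := h1.comp_fst π
  have i2 : Integrable (fun z : E × E => ‖z.2‖ ^ 2) (μ.prod π) := h2.comp_snd μ
  have e : 2 * C ^ 2 * (∫ x, ‖x‖ ^ 2 ∂μ + ∫ x, ‖x‖ ^ 2 ∂π) =
      ∫ z : E × E, 2 * C ^ 2 * (‖z.1‖ ^ 2 + ‖z.2‖ ^ 2) ∂(μ.prod π) := by
    rw [integral_const_mul, integral_add i1 i2, integral_fun_fst (fun x => ‖x‖ ^ 2),
      integral_fun_snd (fun x => ‖x‖ ^ 2)]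
    simp
  have i12 : Integrable (fun z : E × E => 2 * C ^ 2 * (‖z.1‖ ^ 2 + ‖z.2‖ ^ 2)) (μ.prod π) :=
    (i1.add i2).const_mul _
  rw [e, ofReal_integral_eq_lintegral_ofReal i12
    (Filter.Eventually.of_forall fun z => by positivity)]
  refine lintegral_mono fun z => ?_
  rw [← ENNReal.ofReal_pow (apply_nonneg p _)]
  refine ENNReal.ofReal_le_ofReal ?_
  have hC := hp.pos
  have h3 : p (z.1 - z.2) ≤ C * (‖z.1‖ + ‖z.2‖) :=
    (hp.le_norm _).trans (by gcongr; exact norm_sub_le _ _)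
  calc p (z.1 - z.2) ^ 2 ≤ (C * (‖z.1‖ + ‖z.2‖)) ^ 2 := by
        have := apply_nonneg p (z.1 - z.2)
        gcongr
    _ = C ^ 2 * (‖z.1‖ + ‖z.2‖) ^ 2 := by ring
    _ ≤ C ^ 2 * (2 * (‖z.1‖ ^ 2 + ‖z.2‖ ^ 2)) := by
        gcongr
        nlinarith [sq_nonneg (‖z.1‖ - ‖z.2‖)]
    _ = _ := by ring

variable [BorelSpace E]

/-- The geometric bound: the independent coupling of the initial law with the stationary law is run
synchronously up to time `t`. The squared rate `(1 - α (1 - γ)) ^ 2` obtained in this way is at most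
`1 - α (1 - √γ)`, since the rate is at most `1` and `γ ≤ √γ`. -/
theorem W2_sq_map_le [NormedSpace ℝ E] {p : Seminorm ℝ E} (hp : IsEquivNorm p C)
    (hT : IsContractive p γ T) (hα : 0 < α) (hα' : α ≤ 1) {Ω : Type*} [MeasurableSpace Ω]
    {P : Measure Ω} [IsProbabilityMeasure P] {w θ : ℕ → Ω → E} (h : IsSAProcess P T ν α w θ)
    (hθ : MemLp (θ 0) 2 P) {π : Measure E} [IsProbabilityMeasure π] (hπ : MemLp id 2 π)
    (hinv : Kernel.Invariant (saKernel T ν α) π) (t : ℕ) :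
    W2 p (P.map (θ t)) π ^ 2 ≤ ENNReal.ofReal
      (2 * C ^ 2 * (∫ ω, ‖θ 0 ω‖ ^ 2 ∂P + ∫ x, ‖x‖ ^ 2 ∂π) * (1 - α * (1 - √γ)) ^ t) := by
  have hTc := hT.continuous hp
  rw [invariant_saKernel_iff hTc] at hinv
  have hm := h.measurable_init
  have := Measure.isProbabilityMeasure_map (μ := P) hm.aemeasurable
  obtain ⟨hρ0, hρ1⟩ := hT.rate_mem hα hα'
  have hγ : γ ≤ √γ := Real.le_sqrt_of_sq_le (by nlinarith [hT.1, hT.2.1])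
  have hrate : ((1 - α * (1 - γ)) ^ t) ^ 2 ≤ (1 - α * (1 - √γ)) ^ t := by
    calc ((1 - α * (1 - γ)) ^ t) ^ 2 ≤ (1 - α * (1 - γ)) ^ t :=
          pow_le_of_le_one (by positivity) (pow_le_one₀ hρ0.le hρ1.le) two_ne_zero
      _ ≤ _ := by gcongr
  have hmom : ∫ x, ‖x‖ ^ 2 ∂(P.map (θ 0)) = ∫ ω, ‖θ 0 ω‖ ^ 2 ∂P :=
    integral_map hm.aemeasurable (by fun_prop)
  have hmem : MemLp id 2 (P.map (θ 0)) :=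
    (memLp_map_measure_iff aestronglyMeasurable_id hm.aemeasurable).2 hθ
  have hg : Monotone fun r : ℝ => ENNReal.ofReal r ^ 2 := fun a b hab => by
    dsimp only
    gcongr
  set ξ := (P.map (θ 0)).prod π with hξ
  calc W2 p (P.map (θ t)) π ^ 2
      ≤ ∫⁻ z, ENNReal.ofReal (p (z.1 - z.2)) ^ 2 ∂((syncStep T ν α)^[t] ξ) :=
        W2_sq_le p
          (fst_iterate_syncStep hTc (μ := fun t => P.map (θ t)) (by simp [hξ])
            (fun n => h.map_succ hTc n) t)
          (snd_iterate_syncStep hTc (μ := fun _ => π) (by simp [hξ]) (fun _ => hinv) t)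
    _ ≤ ∫⁻ z, ENNReal.ofReal ((1 - α * (1 - γ)) ^ t * p (z.1 - z.2)) ^ 2 ∂ξ :=
        lintegral_iterate_syncStep_le hp hT hα hα' hg t ξ
    _ = ENNReal.ofReal (((1 - α * (1 - γ)) ^ t) ^ 2) *
          ∫⁻ z, ENNReal.ofReal (p (z.1 - z.2)) ^ 2 ∂ξ := by
        have hpm : Measurable p := hp.continuous.measurable
        rw [← lintegral_const_mul _ (by fun_prop)]
        refine lintegral_congr fun z => ?_
        rw [ENNReal.ofReal_mul (by positivity), mul_pow,
          ENNReal.ofReal_pow (pow_nonneg hρ0.le t) 2]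
    _ ≤ ENNReal.ofReal ((1 - α * (1 - √γ)) ^ t) *
          ENNReal.ofReal (2 * C ^ 2 * (∫ ω, ‖θ 0 ω‖ ^ 2 ∂P + ∫ x, ‖x‖ ^ 2 ∂π)) := by
        gcongr
        rw [← hmom]
        exact lintegral_prod_ofReal_sq_le hp hmem hπ
    _ = _ := by
        rw [← ENNReal.ofReal_mul (le_trans (by positivity) hrate), mul_comm]

/-! ### Existence of the stationary law -/

/-- A stationary law with mean square deviation of order `α` from the fixed point. The stationary
solution is built on the space of noise sequences, where index `0` is the present noise value and
larger indices lie further in the past. -/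
theorem exists_invariant [InnerProductSpace ℝ E] [CompleteSpace E] {p : Seminorm ℝ E}
    (hp : IsEquivNorm p C) (hT : IsContractive p γ T) {θ : E} (hθ : T θ = θ)
    (hν : MemLp id 2 ν) (hν0 : ∫ v, v ∂ν = 0) (hα : 0 < α) (hα' : α ≤ 1) :
    ∃ π : Measure E, IsProbabilityMeasure π ∧ MemLp id 2 π ∧
      Kernel.Invariant (saKernel T ν α) π ∧
      ∫ x, ‖x - θ‖ ^ 2 ∂π ≤
        (2 * (C ^ 2 * (γ / (1 - γ))) ^ 2 + 2) * (∫ v, ‖v‖ ^ 2 ∂ν) * α := by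
  set P : Measure (ℕ → E) := Measure.infinitePi fun _ => ν with hP
  set S : (ℕ → E) → (ℕ → E) := fun w n => w (n + 1)
  set W : (ℕ → E) → E := fun w => w 0
  have hSW : MeasurePreserving (fun w => (S w, W w)) P (P.prod ν) :=
    measurePreserving_shift_prodMk_zero ν
  have hS : MeasurePreserving S P P := measurePreserving_fst.comp hSW
  have hWν : MeasurePreserving W P ν := measurePreserving_snd.comp hSW
  have hW : MemLp W 2 P := hν.comp_measurePreserving hWν
  have hSWind : IndepFun S W P := by
    rw [indepFun_iff_map_prod_eq_prod_map_map hS.measurable.aemeasurable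
      hWν.measurable.aemeasurable, hSW.map_eq, hS.map_eq, hWν.map_eq]
  have hW0 : ∫ w, W w ∂P = 0 := by
    rw [← hν0, ← hWν.map_eq, integral_map hWν.measurable.aemeasurable (by fun_prop)]
  have hWsq : ∫ w, ‖W w‖ ^ 2 ∂P = ∫ v, ‖v‖ ^ 2 ∂ν := by
    rw [← hWν.map_eq, integral_map hWν.measurable.aemeasurable (by fun_prop)]
  obtain ⟨X, hXm, hX, hXeq⟩ := exists_stationary_solution hp hT hα hα' hS hW
  obtain ⟨Z, hZm, hZ, hZeq⟩ :=
    exists_stationary_solution hp (isContractive_const hT.1 hT.2.1 0) hα hα' hS hW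
  have hZsq := integral_norm_sq_linear_le hα hα' hS hW hW0 hZ
    (hSWind.comp hZm.measurable measurable_id) hZeq
  refine ⟨P.map X, Measure.isProbabilityMeasure_map hXm.measurable.aemeasurable,
    (memLp_map_measure_iff aestronglyMeasurable_id hXm.measurable.aemeasurable).2 hX,
    invariant_map_of_stationary_solution (hT.continuous hp) hSW hXm.measurable hXeq, ?_⟩
  rw [integral_map hXm.measurable.aemeasurable (by fun_prop)]
  calc _ ≤ (2 * (C ^ 2 * (γ / (1 - γ))) ^ 2 + 2) * ∫ w, ‖Z w‖ ^ 2 ∂P :=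
        integral_norm_sub_sq_le hp hT hα hα' hθ hS hX hZ hXeq hZeq
    _ ≤ (2 * (C ^ 2 * (γ / (1 - γ))) ^ 2 + 2) * (α * ∫ w, ‖W w‖ ^ 2 ∂P) := by gcongr
    _ = _ := by rw [hWsq]; ring

theorem integral_norm_sq_le_of_sub {E : Type*} [NormedAddCommGroup E] [MeasurableSpace E]
    {π : Measure E} [IsProbabilityMeasure π] (hπ : MemLp id 2 π) (θ : E) :
    ∫ x, ‖x‖ ^ 2 ∂π ≤ 2 * ∫ x, ‖x - θ‖ ^ 2 ∂π + 2 * ‖θ‖ ^ 2 := by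
  have h1 : Integrable (fun x => ‖x - θ‖ ^ 2) π :=
    (hπ.sub (memLp_const θ)).integrable_norm_pow two_ne_zero
  have h2 : ∫ x, (2 * ‖x - θ‖ ^ 2 + 2 * ‖θ‖ ^ 2) ∂π =
      2 * ∫ x, ‖x - θ‖ ^ 2 ∂π + 2 * ‖θ‖ ^ 2 := by
    rw [integral_add (h1.const_mul _) (integrable_const _), integral_const_mul]
    simp
  rw [← h2]
  refine integral_mono (hπ.integrable_norm_pow two_ne_zero)
    ((h1.const_mul _).add (integrable_const _)) fun x => ?_
  have h3 : ‖x‖ ≤ ‖x - θ‖ + ‖θ‖ := by simpa using norm_add_le (x - θ) θ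
  have h4 : ‖x‖ ^ 2 ≤ (‖x - θ‖ + ‖θ‖) ^ 2 := by gcongr
  dsimp only
  nlinarith [sq_nonneg (‖x - θ‖ - ‖θ‖)]

end ContractiveSA

theorem mainTheorem5 {d : ℕ}
    -- an arbitrary norm on `ℝ^d`
    (p : Seminorm ℝ (EuclideanSpace ℝ (Fin d))) (hp : ∀ x, p x = 0 → x = 0)
    -- the contractive operator and its fixed point
    (γ : ℝ) (T : EuclideanSpace ℝ (Fin d) → EuclideanSpace ℝ (Fin d))
    (hT : ContractiveSA.IsContractive p γ T)
    (θstar : EuclideanSpace ℝ (Fin d)) (hθstar : T θstar = θstar)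
    -- the common law of the noise: zero mean and finite second moment
    (ν : Measure (EuclideanSpace ℝ (Fin d))) [IsProbabilityMeasure ν]
    (hν_moment : MemLp id 2 ν) (hν_mean : ∫ v, v ∂ν = 0) :
    ∃ αbar : ℝ, 0 < αbar ∧
      (∀ α : ℝ, 0 < α → α ≤ αbar → 1 - α * (1 - √γ) ∈ Set.Ioo (0 : ℝ) 1) ∧
      -- `π α` is the law of the limit for the stepsize `α`
      ∃ π : ℝ → Measure (EuclideanSpace ℝ (Fin d)),
        -- it lies in `P₂` and is the unique stationary distribution of the chain
        (∀ α : ℝ, 0 < α → α ≤ αbar →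
          IsProbabilityMeasure (π α) ∧ MemLp id 2 (π α) ∧
          Kernel.Invariant (ContractiveSA.saKernel T ν α) (π α) ∧
          ∀ π' : Measure (EuclideanSpace ℝ (Fin d)), IsProbabilityMeasure π' →
            Kernel.Invariant (ContractiveSA.saKernel T ν α) π' → π' = π α) ∧
        -- geometric convergence, uniformly over initial second moments at most `R`
        (∀ R : ℝ, ∃ c : ℝ, ∀ α : ℝ, 0 < α → α ≤ αbar →
          ∀ (Ω : Type*) [MeasurableSpace Ω] (P : Measure Ω) [IsProbabilityMeasure P]
            (w θ : ℕ → Ω → EuclideanSpace ℝ (Fin d)),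
            ContractiveSA.IsSAProcess P T ν α w θ →
            MemLp (θ 0) 2 P → ∫ ω, ‖θ 0 ω‖ ^ 2 ∂P ≤ R →
            ∀ t : ℕ, ContractiveSA.W2 p (P.map (θ t)) (π α) ^ 2 ≤
              ENNReal.ofReal (c * (1 - α * (1 - √γ)) ^ t)) ∧
        -- the mean square error of the limit is of order `α`
        ∃ M : ℝ, ∀ α : ℝ, 0 < α → α ≤ αbar →
          ∫ x, ‖x - θstar‖ ^ 2 ∂(π α) ≤ M * α := by
  obtain ⟨C, hC⟩ := ContractiveSA.exists_isEquivNorm p hp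
  set M := (2 * (C ^ 2 * (γ / (1 - γ))) ^ 2 + 2) * ∫ v, ‖v‖ ^ 2 ∂ν with hM
  have hM0 : 0 ≤ M := mul_nonneg (by positivity) (integral_nonneg fun _ => by positivity)
  have hex : ∀ α : ℝ, ∃ π : Measure (EuclideanSpace ℝ (Fin d)), 0 < α → α ≤ 1 →
      IsProbabilityMeasure π ∧ MemLp id 2 π ∧
      Kernel.Invariant (ContractiveSA.saKernel T ν α) π ∧
      ∫ x, ‖x - θstar‖ ^ 2 ∂π ≤ M * α := by
    intro α
    by_cases hα : 0 < α ∧ α ≤ 1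
    · obtain ⟨π, hπ⟩ :=
        ContractiveSA.exists_invariant hC hT hθstar hν_moment hν_mean hα.1 hα.2
      exact ⟨π, fun _ _ => hπ⟩
    · exact ⟨0, fun h h' => absurd ⟨h, h'⟩ hα⟩
  choose π hπ using hex
  refine ⟨1, one_pos, fun α hα hα' => ?_, π, fun α hα hα' => ?_, fun R => ?_,
    M, fun α hα hα' => (hπ α hα hα').2.2.2⟩
  · have h0 : 0 < √γ := Real.sqrt_pos.2 hT.1
    have h1 : √γ < 1 := by
      rw [Real.sqrt_lt' one_pos]
      simpa using hT.2.1
    constructor <;> nlinarith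
  · obtain ⟨hprob, hmem, hinv, -⟩ := hπ α hα hα'
    exact ⟨hprob, hmem, hinv, fun π' _ hinv' =>
      ContractiveSA.invariant_unique hC hT hα hα' hinv hinv'⟩
  · refine ⟨2 * C ^ 2 * (R + (2 * M + 2 * ‖θstar‖ ^ 2)), fun α hα hα' Ω _ P _ w θ h hθ hR t => ?_⟩
    obtain ⟨hprob, hmem, hinv, hmse⟩ := hπ α hα hα'
    have hmom : ∫ x, ‖x‖ ^ 2 ∂(π α) ≤ 2 * M + 2 * ‖θstar‖ ^ 2 := by
      have := ContractiveSA.integral_norm_sq_le_of_sub hmem θstar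
      nlinarith
    have hr : 0 ≤ 1 - α * (1 - √γ) := by
      nlinarith [Real.sqrt_nonneg γ]
    refine (ContractiveSA.W2_sq_map_le hC hT hα hα' h hθ hmem hinv t).trans
      (ENNReal.ofReal_le_ofReal ?_)
    gcongr
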